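/- Let $\mathcal A$ be a finite alphabet and $\mathcal V$ a countable set of variables. *Right-linear lattice (RLL) expressions* are generated by $e ::= X \mid ae \mid 0 \mid \top \mid e+e \mid e\cap e \mid \mu X e \mid \nu X e$ with $X\in\mathcal V$, $a\in\mathcal A$; $\mu X$ and $\nu X$ bind $X$, and an expression is *closed* if it has no free variables. The language $\mathcal L(e)\subseteq\mathcal A^\omega$ of an expression (relative to an assignment of languages to its free variables) is given by $\mathcal L(0)=\varnothing$, $\mathcal L(\top)=\mathcal A^\omega$, $\mathcal L(ae)=\{aw: w\in\mathcal L(e)\}$, $\mathcal L(e+f)=\mathcal L(e)\cup\mathcal L(f)$, $\mathcal L(e\cap f)=\mathcal L(e)\cap\mathcal L(f)$, $\mathcal L(\mu X e(X))=\bigcap\{A : \mathcal L(e(A))\subseteq A\}$ and $\mathcal L(\nu X e(X))=\bigcup\{A : A\subseteq\mathcal L(e(A))\}$, where $\mathcal L(e(A))$ is the language of $e$ with $X$ interpreted as $A\subseteq\mathcal A^\omega$. An *alternating parity automaton* (APA) consists of a finite set $Q$ of states, partitioned into existential and universal states, a set of transitions of the forms $p\to q$ and $p\underset{a}{\to}q$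 ($p,q\in Q$, $a\in\mathcal A$), an initial state $q_0\in Q$ and a colouring $c:Q\to\mathbb N$. A *run-tree* on $w\in\mathcal A^\omega$ is a tree with nodes labelled by pairs $(v,q)$, whose root is labelled $(w,q_0)$. Call $(v,q)$ a successor of $(v,p)$ if $p\to q$ is a transition, and $(v',q)$ a successor of $(av',p)$ if $p\underset{a}{\to}q$ is a transition. A node whose state is existential has exactly one child, labelled by some successor; a node whose state is universal has as children exactly all successors. The APA accepts $w$ if some run-tree on $w$ is such that along each of its infinite paths the least colour occurring infinitely often is even. $\mathcal L(\mathbf A)$ is the set of $\omega$-words accepted by the APA $\mathbf A$. Let $\to_{\mathrm{FL}}$ be the least relation on expressions with $ae\to_{\mathrm{FL}}e$, $e_0+e_1\to_{\mathrm{FL}}e_i$, $e_0\cap e_1\to_{\mathrm{FL}}e_i$ ($i=0,1$), and $\sigma Xe(X)\to_{\mathrm{FL}}e(\sigma Xe(X))$ for $\sigma\in\{\mu,\nu\}$. The *Fischer–Ladner closure* $\mathrm{FL}(e)$ is the set of all expressions reachable from $e$ by $\to_{\mathrm{FL}}$; it is finite for closed $e$. For closed $e$ let $\mathbf A_e$ be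 any APA such that: - its set of states is $\mathrm{FL}(e)$ and its initial state is $e$; states of the form $0$, $f+g$ or $af$ are existential, states of the form $\top$ or $f\cap g$ are universal, and states of the form $\mu Xf$ or $\nu Xf$ may be either; - its transitions are $af\underset{a}{\to}f$ for $af\in\mathrm{FL}(e)$, and $g\to g'$ whenever $g\in\mathrm{FL}(e)$, $g\to_{\mathrm{FL}}g'$ and $g$ is not of the form $af$; - its colouring $c:\mathrm{FL}(e)\to\mathbb N$ satisfies $c(f)\le c(g)$ whenever $f$ is a subformula of $g$, and $c(\mu Xf)$ is always odd and $c(\nu Xf)$ always even. **Theorem.** For every closed RLL expression $e$, and every such choice of $\mathbf A_e$, $\mathcal L(e)=\mathcal L(\mathbf A_e)$. -/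

import Mathlib

/-- Right-linear lattice expressions over the alphabet `𝒜` and the variables `V`. -/
inductive RLL (𝒜 : Type*) (V : Type*) where
  | var (X : V)
  | letter (a : 𝒜) (e : RLL 𝒜 V)
  | zero
  | top
  | plus (e f : RLL 𝒜 V)
  | cap (e f : RLL 𝒜 V)
  | mu (X : V) (e : RLL 𝒜 V)
  | nu (X : V) (e : RLL 𝒜 V)

namespace RLL

variable {𝒜 : Type*} {V : Type*}

/-- Free variables. -/
def FV : RLL 𝒜 V → Set V
  | var X => {X}
  | letter _ e => e.FV
  | zero => ∅
  | top => ∅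
  | plus e f => e.FV ∪ f.FV
  | cap e f => e.FV ∪ f.FV
  | mu X e => e.FV \ {X}
  | nu X e => e.FV \ {X}

def Closed (e : RLL 𝒜 V) : Prop := e.FV = ∅

/-- The language of an expression, under an assignment `ρ` of languages to its free variables. -/
def langIn [DecidableEq V] : RLL 𝒜 V → (V → Set (Stream' 𝒜)) → Set (Stream' 𝒜)
  | var X, ρ => ρ X
  | letter a e, ρ => Stream'.cons a '' e.langIn ρ
  | zero, _ => ∅
  | top, _ => Set.univ
  | plus e f, ρ => e.langIn ρ ∪ f.langIn ρ
  | cap e f, ρ => e.langIn ρ ∩ f.langIn ρ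
  | mu X e, ρ => ⋂₀ {A | e.langIn (Function.update ρ X A) ⊆ A}
  | nu X e, ρ => ⋃₀ {A | A ⊆ e.langIn (Function.update ρ X A)}

/-- The language `ℒ(e)` of a closed expression; the assignment is irrelevant for closed `e`. -/
def lang [DecidableEq V] (e : RLL 𝒜 V) : Set (Stream' 𝒜) := e.langIn fun _ => ∅

/-- `e.subst X s` replaces the free occurrences of `X` in `e` by `s`. It is only used with `s`
closed, so that no variable can be captured. -/
def subst [DecidableEq V] : RLL 𝒜 V → V → RLL 𝒜 V → RLL 𝒜 V
  | var Y, X, s => if Y = X then s else var Y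
  | letter a e, X, s => letter a (e.subst X s)
  | zero, _, _ => zero
  | top, _, _ => top
  | plus e f, X, s => plus (e.subst X s) (f.subst X s)
  | cap e f, X, s => cap (e.subst X s) (f.subst X s)
  | mu Y e, X, s => if Y = X then mu Y e else mu Y (e.subst X s)
  | nu Y e, X, s => if Y = X then nu Y e else nu Y (e.subst X s)

/-- The relation `→_FL`. -/
inductive FLStep [DecidableEq V] : RLL 𝒜 V → RLL 𝒜 V → Prop
  | letter (a : 𝒜) (e : RLL 𝒜 V) : FLStep (.letter a e) e
  | plus_left (e f : RLL 𝒜 V) : FLStep (.plus e f) e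
  | plus_right (e f : RLL 𝒜 V) : FLStep (.plus e f) f
  | cap_left (e f : RLL 𝒜 V) : FLStep (.cap e f) e
  | cap_right (e f : RLL 𝒜 V) : FLStep (.cap e f) f
  | mu (X : V) (e : RLL 𝒜 V) : FLStep (.mu X e) (e.subst X (.mu X e))
  | nu (X : V) (e : RLL 𝒜 V) : FLStep (.nu X e) (e.subst X (.nu X e))

/-- The Fischer-Ladner closure of `e`: everything reachable from `e` by `→_FL`. -/
def FL [DecidableEq V] (e : RLL 𝒜 V) : Set (RLL 𝒜 V) :=
  {f | Relation.ReflTransGen FLStep e f}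

/-- `Sub f g`: `f` is a (not necessarily proper) subformula of `g`. -/
inductive Sub : RLL 𝒜 V → RLL 𝒜 V → Prop
  | refl (e : RLL 𝒜 V) : Sub e e
  | letter {f e : RLL 𝒜 V} (a : 𝒜) : Sub f e → Sub f (.letter a e)
  | plus_left {f e : RLL 𝒜 V} (e' : RLL 𝒜 V) : Sub f e → Sub f (.plus e e')
  | plus_right {f e' : RLL 𝒜 V} (e : RLL 𝒜 V) : Sub f e' → Sub f (.plus e e')
  | cap_left {f e : RLL 𝒜 V} (e' : RLL 𝒜 V) : Sub f e → Sub f (.cap e e')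
  | cap_right {f e' : RLL 𝒜 V} (e : RLL 𝒜 V) : Sub f e' → Sub f (.cap e e')
  | mu {f e : RLL 𝒜 V} (X : V) : Sub f e → Sub f (.mu X e)
  | nu {f e : RLL 𝒜 V} (X : V) : Sub f e → Sub f (.nu X e)

/-! ### Finiteness of the Fischer-Ladner closure -/

section Finiteness

variable [DecidableEq V]

/-- Simultaneous substitution (used only to prove that `FL e` is finite). -/
def inst : RLL 𝒜 V → (V → RLL 𝒜 V) → RLL 𝒜 V
  | var Y, θ => θ Y
  | letter a e, θ => letter a (e.inst θ)
  | zero, _ => zero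
  | top, _ => top
  | plus e f, θ => plus (e.inst θ) (f.inst θ)
  | cap e f, θ => cap (e.inst θ) (f.inst θ)
  | mu Y e, θ => mu Y (e.inst (Function.update θ Y (var Y)))
  | nu Y e, θ => nu Y (e.inst (Function.update θ Y (var Y)))

/-- A finite set containing the Fischer-Ladner closure (used only to prove finiteness). -/
def bound : RLL 𝒜 V → (V → RLL 𝒜 V) → Set (RLL 𝒜 V)
  | var Y, θ => {θ Y}
  | letter a e, θ => insert ((letter a e).inst θ) (e.bound θ)
  | zero, _ => {zero}
  | top, _ => {top}
  | plus e f, θ => insert ((plus e f).inst θ) (e.bound θ ∪ f.bound θ)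
  | cap e f, θ => insert ((cap e f).inst θ) (e.bound θ ∪ f.bound θ)
  | mu Y e, θ => insert ((mu Y e).inst θ) (e.bound (Function.update θ Y ((mu Y e).inst θ)))
  | nu Y e, θ => insert ((nu Y e).inst θ) (e.bound (Function.update θ Y ((nu Y e).inst θ)))

theorem bound_finite (e : RLL 𝒜 V) : ∀ θ, (e.bound θ).Finite := by
  induction e <;> intro θ <;> simp [bound, *]

theorem inst_mem_bound (e : RLL 𝒜 V) (θ) : e.inst θ ∈ e.bound θ := by
  cases e <;> simp [bound, inst]

theorem inst_congr (e : RLL 𝒜 V) : ∀ {θ θ' : V → RLL 𝒜 V}, (∀ Y ∈ e.FV, θ Y = θ' Y) →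
    e.inst θ = e.inst θ' := by
  induction e with
  | var Y => intro θ θ' h; exact h Y rfl
  | letter a e ih => intro θ θ' h; simp only [inst]; rw [ih h]
  | zero => intros; rfl
  | top => intros; rfl
  | plus e f ihe ihf | cap e f ihe ihf =>
    intro θ θ' h; simp only [inst]
    rw [ihe fun Y hY => h Y (Or.inl hY), ihf fun Y hY => h Y (Or.inr hY)]
  | mu X e ih | nu X e ih =>
    intro θ θ' h; simp only [inst]
    rw [ih (θ' := Function.update θ' X (var X))]
    intro Y hY
    by_cases hYX : Y = X
    · subst hYX; simp
    · simp [hYX, h Y ⟨hY, hYX⟩]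

theorem inst_var (e : RLL 𝒜 V) : e.inst var = e := by
  induction e <;> simp_all [inst]

theorem subst_of_notMem (X : V) (s : RLL 𝒜 V) (e : RLL 𝒜 V) (h : X ∉ e.FV) :
    e.subst X s = e := by
  induction e with
  | var Y => simp only [FV, Set.mem_singleton_iff] at h; simp [subst, Ne.symm h]
  | letter a e ih => simp only [subst]; rw [ih h]
  | zero => rfl
  | top => rfl
  | plus e f ihe ihf | cap e f ihe ihf =>
    simp only [FV, Set.mem_union, not_or] at h
    simp only [subst]; rw [ihe h.1, ihf h.2]
  | mu Y e ih | nu Y e ih =>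
    by_cases hYX : Y = X
    · simp [subst, hYX]
    · have : X ∉ e.FV := fun hX => h ⟨hX, fun h' => hYX h'.symm⟩
      simp [subst, hYX, ih this]

theorem subst_inst (X : V) (s : RLL 𝒜 V) (e : RLL 𝒜 V) : ∀ {θ θ' : V → RLL 𝒜 V},
    (∀ Y ∈ e.FV, Y ≠ X → θ Y = θ' Y ∧ (θ Y).subst X s = θ Y) → θ X = var X → θ' X = s →
    (e.inst θ).subst X s = e.inst θ' := by
  induction e with
  | var Y =>
    intro θ θ' h h1 h2
    by_cases hYX : Y = X
    · subst hYX; simp [inst, h1, h2, subst]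
    · obtain ⟨h3, h4⟩ := h Y rfl hYX
      simp only [inst]; rw [h4, h3]
  | letter a e ih => intro θ θ' h h1 h2; simp only [inst, subst]; rw [ih h h1 h2]
  | zero => intros; rfl
  | top => intros; rfl
  | plus e f ihe ihf | cap e f ihe ihf =>
    intro θ θ' h h1 h2; simp only [inst, subst]
    rw [ihe (fun Y hY => h Y (Or.inl hY)) h1 h2, ihf (fun Y hY => h Y (Or.inr hY)) h1 h2]
  | mu Z e ih | nu Z e ih =>
    intro θ θ' h h1 h2
    by_cases hZX : Z = X
    · subst hZX
      simp only [inst, subst, if_true]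
      rw [inst_congr e (θ' := Function.update θ' Z (var Z))]
      intro Y hY
      by_cases hYZ : Y = Z
      · subst hYZ; simp
      · simp [hYZ, (h Y ⟨hY, hYZ⟩ hYZ).1]
    · simp only [inst, subst, hZX, if_false]
      rw [ih (θ' := Function.update θ' Z (var Z))]
      · intro Y hY hYX
        by_cases hYZ : Y = Z
        · subst hYZ; simp [subst, hZX]
        · simpa [hYZ] using h Y ⟨hY, hYZ⟩ hYX
      · simp [Ne.symm hZX, h1]
      · simp [Ne.symm hZX, h2]

theorem FV_inst (e : RLL 𝒜 V) : ∀ (θ : V → RLL 𝒜 V), ∀ X ∈ (e.inst θ).FV,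
    ∃ Y ∈ e.FV, X ∈ (θ Y).FV := by
  induction e with
  | var Y => intro θ X h; exact ⟨Y, rfl, h⟩
  | letter a e ih => exact ih
  | zero => intro θ X h; exact h.elim
  | top => intro θ X h; exact h.elim
  | plus e f ihe ihf | cap e f ihe ihf =>
    rintro θ X (h | h)
    · obtain ⟨Y, hY, hX⟩ := ihe θ X h; exact ⟨Y, Or.inl hY, hX⟩
    · obtain ⟨Y, hY, hX⟩ := ihf θ X h; exact ⟨Y, Or.inr hY, hX⟩
  | mu Z e ih | nu Z e ih =>
    rintro θ X ⟨h, hXZ⟩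
    obtain ⟨Y, hY, hX⟩ := ih _ X h
    by_cases hYZ : Y = Z
    · subst hYZ; simp only [Function.update_self] at hX; exact (hXZ hX).elim
    · exact ⟨Y, ⟨hY, hYZ⟩, by simpa [hYZ] using hX⟩

theorem bound_step (e : RLL 𝒜 V) : ∀ (θ : V → RLL 𝒜 V), (∀ Y ∈ e.FV, (θ Y).FV = ∅) →
    ∀ f ∈ e.bound θ, ∀ g, FLStep f g → g ∈ e.bound θ ∨ ∃ Y ∈ e.FV, f = θ Y := by
  induction e with
  | var Y => intro θ _ f hf g _; exact Or.inr ⟨Y, rfl, hf⟩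
  | letter a e ih =>
    rintro θ hθ f (rfl | hf) g hg
    · cases hg; exact Or.inl (Or.inr (inst_mem_bound e θ))
    · exact (ih θ hθ f hf g hg).imp Or.inr id
  | zero => rintro θ _ f rfl g hg; cases hg
  | top => rintro θ _ f rfl g hg; cases hg
  | plus e f ihe ihf | cap e f ihe ihf =>
    rintro θ hθ k (rfl | hk | hk) g hg
    · cases hg
      · exact Or.inl (Or.inr (Or.inl (inst_mem_bound e θ)))
      · exact Or.inl (Or.inr (Or.inr (inst_mem_bound f θ)))
    · rcases ihe θ (fun Y hY => hθ Y (Or.inl hY)) k hk g hg with h | ⟨Y, hY, h⟩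
      · exact Or.inl (Or.inr (Or.inl h))
      · exact Or.inr ⟨Y, Or.inl hY, h⟩
    · rcases ihf θ (fun Y hY => hθ Y (Or.inr hY)) k hk g hg with h | ⟨Y, hY, h⟩
      · exact Or.inl (Or.inr (Or.inr h))
      · exact Or.inr ⟨Y, Or.inr hY, h⟩
  | mu Z e ih | nu Z e ih =>
    intro θ hθ f hf g hg
    have key : ∀ s : RLL 𝒜 V, (e.inst (Function.update θ Z (var Z))).subst Z s
        = e.inst (Function.update θ Z s) := by
      intro s
      apply subst_inst
      · intro Y hY hYZ
        simp only [Function.update_of_ne hYZ, true_and]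
        exact subst_of_notMem _ _ _ (by rw [hθ Y ⟨hY, hYZ⟩]; exact id)
      · simp
      · simp
    have main : ∀ r : RLL 𝒜 V, r.FV = ∅ →
        (∀ g, FLStep r g → g ∈ e.bound (Function.update θ Z r)) →
        f ∈ insert r (e.bound (Function.update θ Z r)) →
        g ∈ insert r (e.bound (Function.update θ Z r)) ∨ ∃ Y ∈ e.FV \ {Z}, f = θ Y := by
      rintro r hr hroot (rfl | hf)
      · exact Or.inl (Or.inr (hroot g hg))
      · have hcl : ∀ Y ∈ e.FV, (Function.update θ Z r Y).FV = ∅ := by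
          intro Y hY
          by_cases hYZ : Y = Z
          · subst hYZ; rw [Function.update_self]; exact hr
          · rw [Function.update_of_ne hYZ]; exact hθ Y ⟨hY, hYZ⟩
        rcases ih _ hcl f hf g hg with h | ⟨Y, hY, h⟩
        · exact Or.inl (Or.inr h)
        · by_cases hYZ : Y = Z
          · subst hYZ
            rw [Function.update_self] at h
            subst h
            exact Or.inl (Or.inr (hroot g hg))
          · rw [Function.update_of_ne hYZ] at h
            exact Or.inr ⟨Y, ⟨hY, hYZ⟩, h⟩
    refine main _ (Set.eq_empty_of_forall_notMem fun X hX => ?_) (fun g hg => ?_) hf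
    · obtain ⟨W, hW, hX⟩ := FV_inst _ _ _ hX
      rw [hθ W hW] at hX
      exact hX
    · cases hg
      rw [key]
      exact inst_mem_bound _ _

theorem FL_finite {e : RLL 𝒜 V} (he : e.Closed) : e.FL.Finite := by
  have he : e.FV = ∅ := he
  refine (bound_finite e var).subset fun f (hf : Relation.ReflTransGen FLStep e f) => ?_
  induction hf with
  | refl => simpa [inst_var] using inst_mem_bound e var
  | tail _ hg ih =>
    rcases bound_step e var (by simp [he]) _ ih _ hg with h | ⟨Y, hY, _⟩
    · exact h
    · rw [he] at hY; exact hY.elim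

end Finiteness

end RLL

/-- Transitions `X → Y` and `X →ₐ Y`. -/
inductive APATransition (𝒜 : Type*) (Q : Type*) where
  | eps (X Y : Q)
  | read (X : Q) (a : 𝒜) (Y : Q)

/-- Alternating parity automata over `𝒜` with state set `Q`. The universal states are those outside
`existential`. As `Q` is finite, a colouring `Q → ℕ` takes values in some `{0, …, n}`. -/
structure APA (𝒜 : Type*) (Q : Type*) where
  finite : Finite Q
  existential : Set Q
  transitions : Set (APATransition 𝒜 Q)
  init : Q
  colour : Q → ℕ

namespace APA

variable {𝒜 : Type*} {Q : Type*}

/-- `M.Succ (v, X) (v', Y)`: some transition of `M` allows `(v', Y)` as a child of `(v, X)`. -/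
inductive Succ (M : APA 𝒜 Q) : Stream' 𝒜 × Q → Stream' 𝒜 × Q → Prop
  | eps {X Y : Q} (v : Stream' 𝒜) : APATransition.eps X Y ∈ M.transitions → Succ M (v, X) (v, Y)
  | read {X Y : Q} {a : 𝒜} (v : Stream' 𝒜) : APATransition.read X a Y ∈ M.transitions →
      Succ M (Stream'.cons a v, X) (v, Y)

/-- `T` is a run-tree of `M` on `w`. A node of the tree is given by the list of labels on the
branch leading to it, *last label first*: the node `p :: h` has label `p`, and its children are the
nodes `q :: p :: h` in `T`. So distinct nodes may carry the same label. -/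
structure IsRunTree (M : APA 𝒜 Q) (w : Stream' 𝒜) (T : Set (List (Stream' 𝒜 × Q))) : Prop where
  root_mem : [(w, M.init)] ∈ T
  /-- Every node is the root or a child of a node. -/
  root_or_child : ∀ n ∈ T, n = [(w, M.init)] ∨ ∃ p, ∃ h ∈ T, n = p :: h
  /-- An existential node has exactly one child, given by some transition. -/
  exists_child : ∀ p h, p :: h ∈ T → p.2 ∈ M.existential →
    ∃ q, M.Succ p q ∧ ∀ r, r :: p :: h ∈ T ↔ r = q
  /-- A universal node has as children exactly those given by the transitions. -/
  forall_child : ∀ p h, p :: h ∈ T → p.2 ∉ M.existential →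
    ∀ r, r :: p :: h ∈ T ↔ M.Succ p r

/-- The node reached after `n` steps along a sequence of labels. -/
def nodeAt {α : Type*} (π : ℕ → α) : ℕ → List α
  | 0 => [π 0]
  | n + 1 => π (n + 1) :: nodeAt π n

/-- `π` is (the sequence of labels of) an infinite path of the tree `T`, starting at the root. -/
def IsPath {α : Type*} (T : Set (List α)) (π : ℕ → α) : Prop := ∀ n, nodeAt π n ∈ T

/-- The least colour occurring infinitely often along `π` is even. -/
def IsAcceptingPath (M : APA 𝒜 Q) (π : ℕ → Stream' 𝒜 × Q) : Prop :=
  ∃ k, IsLeast {k | ∃ᶠ n in Filter.atTop, M.colour (π n).2 = k} k ∧ Even k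

def Accepts (M : APA 𝒜 Q) (w : Stream' 𝒜) : Prop :=
  ∃ T, M.IsRunTree w T ∧ ∀ π, IsPath T π → M.IsAcceptingPath π

def lang (M : APA 𝒜 Q) : Set (Stream' 𝒜) := {w | M.Accepts w}

end APA

namespace RLL

variable {𝒜 : Type*} {V : Type*} [DecidableEq V]

/-- Admissible sets of existential states: `0`, `f + g` and `af` are existential, `⊤` and `f ∩ g`
are universal; for `μ`- and `ν`-formulas, which have a unique successor, the choice is free. -/
structure IsExistentialSet (e : RLL 𝒜 V) (E : Set e.FL) : Prop where
  zero : ∀ s : e.FL, s.1 = .zero → s ∈ E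
  plus : ∀ (s : e.FL) (f g : RLL 𝒜 V), s.1 = .plus f g → s ∈ E
  letter : ∀ (s : e.FL) (a : 𝒜) (f : RLL 𝒜 V), s.1 = .letter a f → s ∈ E
  top : ∀ s : e.FL, s.1 = .top → s ∉ E
  cap : ∀ (s : e.FL) (f g : RLL 𝒜 V), s.1 = .cap f g → s ∉ E

/-- Admissible colourings of the Fischer-Ladner closure of `e`. -/
structure IsColouring (e : RLL 𝒜 V) (c : e.FL → ℕ) : Prop where
  mono : ∀ f g : e.FL, Sub f.1 g.1 → c f ≤ c g
  mu : ∀ (s : e.FL) (X : V) (f : RLL 𝒜 V), s.1 = .mu X f → Odd (c s)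
  nu : ∀ (s : e.FL) (X : V) (f : RLL 𝒜 V), s.1 = .nu X f → Even (c s)

/-- The number of symbols of an expression (used only to exhibit a colouring). -/
def size : RLL 𝒜 V → ℕ
  | var _ => 1
  | letter _ e => e.size + 1
  | zero => 1
  | top => 1
  | plus e f => e.size + f.size + 1
  | cap e f => e.size + f.size + 1
  | mu _ e => e.size + 1
  | nu _ e => e.size + 1

/-- Admissible sets of existential states and admissible colourings exist. -/
theorem exists_isExistentialSet_isColouring (e : RLL 𝒜 V) :
    (∃ E, e.IsExistentialSet E) ∧ ∃ c, e.IsColouring c := by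
  classical
  refine ⟨⟨{s | s.1 ≠ .top ∧ ∀ f g, s.1 ≠ .cap f g}, ?_⟩,
    fun s => 2 * s.1.size + if ∃ X f, s.1 = .mu X f then 1 else 0, ?_, ?_, ?_⟩
  · constructor <;> intros <;> simp_all
  · have h : ∀ f g : RLL 𝒜 V, Sub f g → f = g ∨ f.size < g.size := by
      intro f g hfg
      induction hfg with
      | refl => exact Or.inl rfl
      | _ =>
        rename_i ih
        rcases ih with rfl | ih <;> right <;> simp only [size] <;> omega
    intro f g hfg
    rcases h _ _ hfg with h | h
    · simp only [h]; exact le_rfl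
    · split_ifs <;> omega
  · intro s X f h
    simp [h]
  · intro s X f h
    simp [h]

/-- The automaton `A_e` of a closed expression `e`, for a given set `E` of existential states and a
given colouring `c`. -/
def automaton (e : RLL 𝒜 V) (he : e.Closed) (E : Set e.FL) (c : e.FL → ℕ) : APA 𝒜 e.FL where
  finite := (FL_finite he).to_subtype
  existential := E
  transitions := {t | match t with
    | .eps g g' => FLStep g.1 g'.1 ∧ ∀ a f, g.1 ≠ .letter a f
    | .read g a f => g.1 = .letter a f.1}
  init := ⟨e, Relation.ReflTransGen.refl⟩
  colour := c

end RLL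

namespace RLL

variable {𝒜 : Type*} {V : Type*}

/-! ### Subformulas and infinite Fischer-Ladner traces -/

theorem Sub.trans {f g h : RLL 𝒜 V} (hfg : Sub f g) (hgh : Sub g h) : Sub f h := by
  induction hgh with
  | refl => exact hfg
  | letter a _ ih => exact .letter a ih
  | plus_left _ _ ih => exact .plus_left _ ih
  | plus_right _ _ ih => exact .plus_right _ ih
  | cap_left _ _ ih => exact .cap_left _ ih
  | cap_right _ _ ih => exact .cap_right _ ih
  | mu X _ ih => exact .mu X ih
  | nu X _ ih => exact .nu X ih

theorem Sub.eq_or_size_lt {f g : RLL 𝒜 V} (h : Sub f g) : f = g ∨ f.size < g.size := by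
  induction h with
  | refl => exact Or.inl rfl
  | _ =>
    rename_i ih
    rcases ih with rfl | ih <;> right <;> simp only [size] <;> omega

theorem Sub.size_le {f g : RLL 𝒜 V} (h : Sub f g) : f.size ≤ g.size := by
  rcases h.eq_or_size_lt with rfl | h
  · exact le_rfl
  · exact h.le

section Subst

variable [DecidableEq V]

theorem sub_subst_of_mem_FV {X : V} (s : RLL 𝒜 V) {e : RLL 𝒜 V} (h : X ∈ e.FV) :
    Sub s (e.subst X s) := by
  induction e with
  | var Y =>
    obtain rfl : X = Y := h
    simpa [subst] using Sub.refl s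
  | letter a e ih => exact .letter a (ih h)
  | zero => exact h.elim
  | top => exact h.elim
  | plus e f ihe ihf =>
    rcases h with h | h
    · exact .plus_left _ (ihe h)
    · exact .plus_right _ (ihf h)
  | cap e f ihe ihf =>
    rcases h with h | h
    · exact .cap_left _ (ihe h)
    · exact .cap_right _ (ihf h)
  | mu Y e ih =>
    have hYX : Y ≠ X := fun h' => h.2 h'.symm
    simpa [subst, hYX] using Sub.mu Y (ih h.1)
  | nu Y e ih =>
    have hYX : Y ≠ X := fun h' => h.2 h'.symm
    simpa [subst, hYX] using Sub.nu Y (ih h.1)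

/-- A subformula of `e(s)` comes from `s` or from `e`, or contains `s`. -/
theorem Sub.of_subst {X : V} {s f e : RLL 𝒜 V} (h : Sub f (e.subst X s)) :
    Sub f s ∨ Sub f e ∨ Sub s f := by
  by_cases hX : X ∈ e.FV
  swap
  · rw [subst_of_notMem _ _ _ hX] at h
    exact Or.inr (Or.inl h)
  have hs := sub_subst_of_mem_FV s hX
  induction e with
  | var Y =>
    obtain rfl : X = Y := hX
    exact Or.inl (by simpa [subst] using h)
  | zero => exact hX.elim
  | top => exact hX.elim
  | letter a e ih =>
    cases h with
    | refl => exact Or.inr (Or.inr hs)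
    | letter _ h =>
      exact (ih h hX (sub_subst_of_mem_FV s hX)).imp_right (Or.imp_left (Sub.letter a))
  | plus e g ihe ihg =>
    cases h with
    | refl => exact Or.inr (Or.inr hs)
    | plus_left _ h =>
      by_cases hX : X ∈ e.FV
      · exact (ihe h hX (sub_subst_of_mem_FV s hX)).imp_right (Or.imp_left (Sub.plus_left g))
      · rw [subst_of_notMem _ _ _ hX] at h
        exact Or.inr (Or.inl (.plus_left _ h))
    | plus_right _ h =>
      by_cases hX : X ∈ g.FV
      · exact (ihg h hX (sub_subst_of_mem_FV s hX)).imp_right (Or.imp_left (Sub.plus_right e))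
      · rw [subst_of_notMem _ _ _ hX] at h
        exact Or.inr (Or.inl (.plus_right _ h))
  | cap e g ihe ihg =>
    cases h with
    | refl => exact Or.inr (Or.inr hs)
    | cap_left _ h =>
      by_cases hX : X ∈ e.FV
      · exact (ihe h hX (sub_subst_of_mem_FV s hX)).imp_right (Or.imp_left (Sub.cap_left g))
      · rw [subst_of_notMem _ _ _ hX] at h
        exact Or.inr (Or.inl (.cap_left _ h))
    | cap_right _ h =>
      by_cases hX : X ∈ g.FV
      · exact (ihg h hX (sub_subst_of_mem_FV s hX)).imp_right (Or.imp_left (Sub.cap_right e))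
      · rw [subst_of_notMem _ _ _ hX] at h
        exact Or.inr (Or.inl (.cap_right _ h))
  | mu Y e ih =>
    have hYX : Y ≠ X := fun h' => hX.2 h'.symm
    simp only [subst, hYX, if_false] at h hs
    cases h with
    | refl => exact Or.inr (Or.inr hs)
    | mu _ h =>
      exact (ih h hX.1 (sub_subst_of_mem_FV s hX.1)).imp_right (Or.imp_left (Sub.mu Y))
  | nu Y e ih =>
    have hYX : Y ≠ X := fun h' => hX.2 h'.symm
    simp only [subst, hYX, if_false] at h hs
    cases h with
    | refl => exact Or.inr (Or.inr hs)
    | nu _ h =>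
      exact (ih h hX.1 (sub_subst_of_mem_FV s hX.1)).imp_right (Or.imp_left (Sub.nu Y))

theorem FLStep.sub_of_sub {f f' s : RLL 𝒜 V} (h : FLStep f f') (hs : Sub s f')
    (hsize : s.size ≤ f.size) : Sub s f := by
  have key : Sub f s → Sub s f := fun h' => by
    rcases h'.eq_or_size_lt with rfl | h'
    · exact .refl _
    · omega
  cases h with
  | letter a e => exact .letter a hs
  | plus_left e f => exact .plus_left _ hs
  | plus_right e f => exact .plus_right _ hs
  | cap_left e f => exact .cap_left _ hs
  | cap_right e f => exact .cap_right _ hs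
  | mu X e =>
    rcases hs.of_subst with h | h | h
    · exact h
    · exact .mu X h
    · exact key h
  | nu X e =>
    rcases hs.of_subst with h | h | h
    · exact h
    · exact .nu X h
    · exact key h

theorem FLStep.eq_mu_or_nu_of_size_le {f f' : RLL 𝒜 V} (h : FLStep f f')
    (hsize : f.size ≤ f'.size) : (∃ X e, f = .mu X e) ∨ ∃ X e, f = .nu X e := by
  cases h with
  | mu X e => exact Or.inl ⟨X, e, rfl⟩
  | nu X e => exact Or.inr ⟨X, e, rfl⟩
  | _ => simp only [size] at hsize; omega

/-- An infinite Fischer-Ladner trace through a finite set visits infinitely often some fixed point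
formula that is eventually a subformula of every formula on the trace. -/
theorem exists_frequently_eventually_sub {S : Set (RLL 𝒜 V)} (hS : S.Finite) (t : ℕ → S)
    (ht : ∀ n, FLStep (t n).1 (t (n + 1)).1) :
    ∃ s : S, (∃ᶠ n in Filter.atTop, t n = s) ∧ (∀ᶠ n in Filter.atTop, Sub s.1 (t n).1) ∧
      ((∃ X e, s.1 = .mu X e) ∨ ∃ X e, s.1 = .nu X e) := by
  have := hS.to_subtype
  let I : Set S := {s | ∃ᶠ n in Filter.atTop, t n = s}
  have hI : ∀ᶠ n in Filter.atTop, t n ∈ I := by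
    have h : ∀ᶠ n in Filter.atTop, ∀ s : S, s ∉ I → t n ≠ s := by
      rw [Filter.eventually_all]
      intro s
      by_cases hs : s ∈ I
      · simp [hs]
      · filter_upwards [Filter.not_frequently.mp hs] with n hn _ using hn
    filter_upwards [h] with n hn
    by_contra hc
    exact hn _ hc rfl
  obtain ⟨N, hN⟩ := Filter.eventually_atTop.mp hI
  obtain ⟨s, hsI, hmin⟩ :=
    Set.exists_min_image I (fun s => s.1.size) (Set.toFinite I) ⟨t N, hN N le_rfl⟩
  have hsI' : ∃ᶠ n in Filter.atTop, t n = s := hsI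
  have back : ∀ k n, N ≤ n → t (n + k) = s → Sub s.1 (t n).1 := by
    intro k
    induction k with
    | zero => rintro n - h; rw [← h]; exact .refl _
    | succ k ih =>
      intro n hn h
      exact (ht n).sub_of_sub (ih (n + 1) (by omega) (by rw [← h]; congr 1; omega))
        (hmin _ (hN n hn))
  have hsub : ∀ n, N ≤ n → Sub s.1 (t n).1 := by
    intro n hn
    obtain ⟨m, hm, hms⟩ := Filter.frequently_atTop.mp hsI' n
    exact back (m - n) n hn (by rw [← hms]; congr 1; omega)
  refine ⟨s, hsI', Filter.eventually_atTop.mpr ⟨N, hsub⟩, ?_⟩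
  obtain ⟨m, hm, hms⟩ := Filter.frequently_atTop.mp hsI' N
  rw [← hms]
  apply (ht m).eq_mu_or_nu_of_size_le
  rw [hms]
  exact (hsub (m + 1) (by omega)).size_le

/-! ### Closed expressions -/

theorem FV_subst_subset (X : V) (s e : RLL 𝒜 V) : (e.subst X s).FV ⊆ (e.FV \ {X}) ∪ s.FV := by
  induction e with
  | var Y =>
    by_cases h : Y = X
    · simp [subst, h]
    · simp [subst, h, FV]
  | letter a e ih => exact ih
  | zero => exact Set.empty_subset _
  | top => exact Set.empty_subset _
  | plus e f ihe ihf | cap e f ihe ihf =>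
    rintro Y (h | h)
    · exact (ihe h).imp_left fun h => ⟨Or.inl h.1, h.2⟩
    · exact (ihf h).imp_left fun h => ⟨Or.inr h.1, h.2⟩
  | mu Z e ih | nu Z e ih =>
    by_cases hZX : Z = X
    · subst hZX
      simp [subst, FV]
    · simp only [subst, hZX, if_false]
      rintro Y ⟨h, hYZ⟩
      exact (ih h).imp_left fun h => ⟨⟨h.1, hYZ⟩, h.2⟩

theorem FLStep.closed {f g : RLL 𝒜 V} (h : FLStep f g) (hf : f.Closed) : g.Closed := by
  have hf : f.FV = ∅ := hf
  cases h with
  | letter a e => exact hf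
  | plus_left | cap_left => exact (Set.union_empty_iff.mp hf).1
  | plus_right | cap_right => exact (Set.union_empty_iff.mp hf).2
  | mu X e | nu X e =>
    refine Set.subset_empty_iff.mp ((FV_subst_subset X _ e).trans ?_)
    rw [hf, Set.union_empty]
    exact hf.subset

theorem closed_of_mem_FL {e f : RLL 𝒜 V} (he : e.Closed) (hf : f ∈ e.FL) : f.Closed := by
  change Relation.ReflTransGen FLStep e f at hf
  induction hf with
  | refl => exact he
  | tail _ h ih => exact h.closed ih

end Subst

end RLL

/-! ### Transfinite approximants of least fixed points -/

section Approx

universe u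

variable {α : Type u}

/-- The approximants `⋃_{β < o} F (F^β)` of the least fixed point of `F`; the stage `⊤` is the least
fixed point itself. -/
noncomputable def lfpStage (F : Set α → Set α) (o : WithTop Ordinal.{u}) : Set α :=
  ⋃ β : {β : WithTop Ordinal.{u} // β < o}, F (lfpStage F β.1)
termination_by wellFounded_lt.wrap o
decreasing_by exact β.2

theorem mem_lfpStage {F : Set α → Set α} {o : WithTop Ordinal.{u}} {x : α} :
    x ∈ lfpStage F o ↔ ∃ β < o, x ∈ F (lfpStage F β) := by
  rw [lfpStage]
  simp

theorem lfpStage_mono_stage (F : Set α → Set α) : Monotone (lfpStage F) := by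
  intro o o' h x hx
  obtain ⟨β, hβ, hx⟩ := mem_lfpStage.mp hx
  exact mem_lfpStage.mpr ⟨β, hβ.trans_le h, hx⟩

theorem lfpStage_mono {F G : Set α → Set α} (hG : Monotone G) (h : ∀ A, F A ⊆ G A)
    (o : WithTop Ordinal.{u}) : lfpStage F o ⊆ lfpStage G o := by
  induction o using WellFoundedLT.induction with
  | ind o ih =>
    intro x hx
    obtain ⟨β, hβ, hx⟩ := mem_lfpStage.mp hx
    exact mem_lfpStage.mpr ⟨β, hβ, hG (ih β hβ) (h _ hx)⟩

theorem lfpStage_subset {F : Set α → Set α} (hF : Monotone F) {A : Set α} (hA : F A ⊆ A)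
    (o : WithTop Ordinal.{u}) : lfpStage F o ⊆ A := by
  induction o using WellFoundedLT.induction with
  | ind o ih =>
    intro x hx
    obtain ⟨β, hβ, hx⟩ := mem_lfpStage.mp hx
    exact hA (hF (ih β hβ) hx)

theorem image_lfpStage_top_subset {F : Set α → Set α} (hF : Monotone F) :
    F (lfpStage F ⊤) ⊆ lfpStage F ⊤ := by
  have key : ∀ a b : Ordinal.{u}, a < b → lfpStage F a = lfpStage F b →
      F (lfpStage F ⊤) ⊆ lfpStage F ⊤ := by
    intro a b hab h
    have hpre : F (lfpStage F a) ⊆ lfpStage F a := by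
      rw [h]
      intro x hx
      rw [← h] at hx
      exact mem_lfpStage.mpr ⟨a, WithTop.coe_lt_coe.mpr hab, hx⟩
    exact (hF (lfpStage_subset hF hpre ⊤)).trans
      (hpre.trans (lfpStage_mono_stage F le_top))
  have hinj := not_injective_of_ordinal (fun a : Ordinal.{u} => lfpStage F a)
  simp only [Function.Injective, not_forall] at hinj
  obtain ⟨a, b, h, hne⟩ := hinj
  rcases lt_or_gt_of_ne hne with hab | hab
  · exact key a b hab h
  · exact key b a hab h.symm

theorem lfpStage_top {F : Set α → Set α} (hF : Monotone F) :
    lfpStage F ⊤ = ⋂₀ {A | F A ⊆ A} :=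
  (Set.subset_sInter fun _ hA => lfpStage_subset hF hA ⊤).antisymm
    (Set.sInter_subset_of_mem (image_lfpStage_top_subset hF))

end Approx

/-! ### Signatures -/

namespace RLL

universe u

variable {𝒜 : Type u} {V : Type*}

/-- A sequence that eventually never increases cannot decrease infinitely often. -/
theorem not_frequently_lt_of_eventually_le {α : Type*} [LinearOrder α] [WellFoundedLT α]
    {u : ℕ → α} (hle : ∀ᶠ n in Filter.atTop, u (n + 1) ≤ u n) :
    ¬ ∃ᶠ n in Filter.atTop, u (n + 1) < u n := by
  intro hlt
  obtain ⟨N, hN⟩ := Filter.eventually_atTop.mp hle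
  have anti : ∀ m n, N ≤ m → m ≤ n → u n ≤ u m := by
    intro m n hm hmn
    induction n, hmn using Nat.le_induction with
    | base => exact le_rfl
    | succ n hn ih => exact (hN n (hm.trans hn)).trans ih
  obtain ⟨_, ⟨m, hm, rfl⟩, hmin⟩ := WellFounded.has_min (wellFounded_lt (α := α))
    (u '' Set.Ici N) ⟨_, N, Set.self_mem_Ici, rfl⟩
  obtain ⟨n, hn, hlt'⟩ := Filter.frequently_atTop.mp hlt m
  have hm : N ≤ m := hm
  exact hmin _ ⟨n + 1, show N ≤ n + 1 by omega, rfl⟩ (hlt'.trans_le (anti m n hm hn))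

open Classical in
/-- The signature `κ` with stage `β` at `s` and stage `⊤` at all proper superformulas of `s`. -/
noncomputable def resetSig (κ : RLL 𝒜 V → WithTop Ordinal.{u}) (s : RLL 𝒜 V)
    (β : WithTop Ordinal.{u}) (g : RLL 𝒜 V) : WithTop Ordinal.{u} :=
  if g = s then β else if Sub s g then ⊤ else κ g

theorem resetSig_self (κ : RLL 𝒜 V → WithTop Ordinal.{u}) (s : RLL 𝒜 V)
    (β : WithTop Ordinal.{u}) : resetSig κ s β s = β := by
  simp [resetSig]

theorem resetSig_of_size_lt (κ : RLL 𝒜 V → WithTop Ordinal.{u}) {s g : RLL 𝒜 V}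
    (β : WithTop Ordinal.{u}) (h : g.size < s.size) : resetSig κ s β g = κ g := by
  have h1 : g ≠ s := by rintro rfl; omega
  have h2 : ¬ Sub s g := fun h' => by have := h'.size_le; omega
  simp [resetSig, h1, h2]

theorem resetSig_eq_top {κ : RLL 𝒜 V → WithTop Ordinal.{u}} {s g : RLL 𝒜 V}
    {β : WithTop Ordinal.{u}} (hg : κ g = ⊤) (h : g = s → β = ⊤) : resetSig κ s β g = ⊤ := by
  by_cases h1 : g = s
  · simp [resetSig, h1, h h1]
  · simp [resetSig, h1, hg]

theorem resetSig_le {κ : RLL 𝒜 V → WithTop Ordinal.{u}} {s g : RLL 𝒜 V}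
    {β : WithTop Ordinal.{u}} (h : Sub g s) (hβ : β ≤ κ s) : resetSig κ s β g ≤ κ g := by
  rcases h.eq_or_size_lt with rfl | hlt
  · rwa [resetSig_self]
  · rw [resetSig_of_size_lt κ β hlt]

/-- `κ'` results from `κ` by a step at `f` in which the stages of subformulas of `f` do not
increase, the stage of `f` itself decreasing if `P f`. -/
def SigStep (P : RLL 𝒜 V → Prop) (f : RLL 𝒜 V) (κ κ' : RLL 𝒜 V → WithTop Ordinal.{u}) : Prop :=
  (∀ g, Sub g f → κ' g ≤ κ g) ∧ (P f → κ' f < κ f)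

theorem SigStep.refl {P : RLL 𝒜 V → Prop} {f : RLL 𝒜 V} (hf : ¬ P f)
    (κ : RLL 𝒜 V → WithTop Ordinal.{u}) : SigStep P f κ κ :=
  ⟨fun _ _ => le_rfl, fun h => (hf h).elim⟩

theorem SigStep.resetSig_of_lt (P : RLL 𝒜 V → Prop) {f : RLL 𝒜 V}
    {κ : RLL 𝒜 V → WithTop Ordinal.{u}} {β : WithTop Ordinal.{u}} (h : β < κ f) :
    SigStep P f κ (resetSig κ f β) :=
  ⟨fun _ hg => resetSig_le hg h.le, fun _ => by rwa [resetSig_self]⟩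

theorem SigStep.resetSig_top {P : RLL 𝒜 V → Prop} {f : RLL 𝒜 V} (hf : ¬ P f)
    {κ : RLL 𝒜 V → WithTop Ordinal.{u}} (h : κ f = ⊤) : SigStep P f κ (resetSig κ f ⊤) :=
  ⟨fun _ hg => resetSig_le hg h.ge, fun h => (hf h).elim⟩

theorem not_frequently_of_sigStep {P : RLL 𝒜 V → Prop} {t : ℕ → RLL 𝒜 V}
    {κ : ℕ → RLL 𝒜 V → WithTop Ordinal.{u}} (h : ∀ n, SigStep P (t n) (κ n) (κ (n + 1)))
    {s : RLL 𝒜 V} (hs : P s) (hsub : ∀ᶠ n in Filter.atTop, Sub s (t n)) :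
    ¬ ∃ᶠ n in Filter.atTop, t n = s := by
  intro hfreq
  refine not_frequently_lt_of_eventually_le (u := fun n => κ n s)
    (hsub.mono fun n hn => (h n).1 s hn) (hfreq.mono fun n hn => ?_)
  subst hn
  exact (h n).2 hs

def IsMu (f : RLL 𝒜 V) : Prop := ∃ X g, f = .mu X g

def IsNu (f : RLL 𝒜 V) : Prop := ∃ X g, f = .nu X g

/-- Signatures approximating only closed formulas satisfying `P`. -/
def IsSig (P : RLL 𝒜 V → Prop) (κ : RLL 𝒜 V → WithTop Ordinal.{u}) : Prop :=
  ∀ g, ¬ (g.Closed ∧ P g) → κ g = ⊤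

theorem IsSig.resetSig {P : RLL 𝒜 V → Prop} {κ : RLL 𝒜 V → WithTop Ordinal.{u}} (hκ : IsSig P κ)
    {s : RLL 𝒜 V} {β : WithTop Ordinal.{u}} (h : s.Closed ∧ P s ∨ β = ⊤) :
    IsSig P (resetSig κ s β) := by
  intro g hg
  refine resetSig_eq_top (hκ g hg) ?_
  rintro rfl
  exact h.resolve_left hg

theorem IsSig.eq_top_of_not_closed {P : RLL 𝒜 V → Prop} {κ : RLL 𝒜 V → WithTop Ordinal.{u}}
    (hκ : IsSig P κ) (g : RLL 𝒜 V) (hg : ¬ g.Closed) : κ g = ⊤ :=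
  hκ g fun h => hg h.1

end RLL

/-! ### Languages relative to signatures -/

namespace RLL

universe u

variable {𝒜 : Type u} {V : Type*} [DecidableEq V]

/-- The language of an expression in which every fixed point subformula `g` is replaced by its
approximant at stage `κ g`, from below for `μ` and from above for `ν`. -/
noncomputable def langSig (κ : RLL 𝒜 V → WithTop Ordinal.{u}) :
    RLL 𝒜 V → (V → Set (Stream' 𝒜)) → Set (Stream' 𝒜)
  | var X, ρ => ρ X
  | letter a e, ρ => Stream'.cons a '' e.langSig κ ρ
  | zero, _ => ∅
  | top, _ => Set.univ
  | plus e f, ρ => e.langSig κ ρ ∪ f.langSig κ ρ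
  | cap e f, ρ => e.langSig κ ρ ∩ f.langSig κ ρ
  | mu X e, ρ => lfpStage (fun A => e.langSig κ (Function.update ρ X A)) (κ (mu X e))
  | nu X e, ρ => (lfpStage (fun A => (e.langSig κ (Function.update ρ X Aᶜ))ᶜ) (κ (nu X e)))ᶜ

theorem langSig_mono (κ : RLL 𝒜 V → WithTop Ordinal.{u}) (e : RLL 𝒜 V) :
    Monotone (e.langSig κ) := by
  induction e with
  | var X => intro ρ ρ' h; exact h X
  | letter a e ih => intro ρ ρ' h; exact Set.image_mono (ih h)
  | zero => intro ρ ρ' h; exact le_rfl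
  | top => intro ρ ρ' h; exact le_rfl
  | plus e f ihe ihf => intro ρ ρ' h; exact Set.union_subset_union (ihe h) (ihf h)
  | cap e f ihe ihf => intro ρ ρ' h; exact Set.inter_subset_inter (ihe h) (ihf h)
  | mu X e ih =>
    intro ρ ρ' h
    exact lfpStage_mono
      (fun A B hAB => ih (update_le_update_iff.mpr ⟨hAB, fun _ _ => le_rfl⟩))
      (fun A => ih (update_le_update_iff.mpr ⟨le_rfl, fun Y _ => h Y⟩)) _
  | nu X e ih =>
    intro ρ ρ' h
    exact Set.compl_subset_compl.mpr (lfpStage_mono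
      (fun A B hAB => Set.compl_subset_compl.mpr
        (ih (update_le_update_iff.mpr ⟨Set.compl_subset_compl.mpr hAB, fun _ _ => le_rfl⟩)))
      (fun A => Set.compl_subset_compl.mpr
        (ih (update_le_update_iff.mpr ⟨le_rfl, fun Y _ => h Y⟩))) _)

theorem langSig_body_mono (κ : RLL 𝒜 V → WithTop Ordinal.{u}) (X : V) (e : RLL 𝒜 V)
    (ρ : V → Set (Stream' 𝒜)) : Monotone fun A => e.langSig κ (Function.update ρ X A) :=
  fun _ _ h => langSig_mono κ e (update_le_update_iff.mpr ⟨h, fun _ _ => le_rfl⟩)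

theorem langSig_body_compl_mono (κ : RLL 𝒜 V → WithTop Ordinal.{u}) (X : V) (e : RLL 𝒜 V)
    (ρ : V → Set (Stream' 𝒜)) : Monotone fun A => (e.langSig κ (Function.update ρ X Aᶜ))ᶜ :=
  fun _ _ h => Set.compl_subset_compl.mpr
    (langSig_body_mono κ X e ρ (Set.compl_subset_compl.mpr h))

theorem langSig_top (e : RLL 𝒜 V) : ∀ ρ, e.langSig (fun _ => ⊤) ρ = e.langIn ρ := by
  induction e with
  | var X => intro ρ; rfl
  | letter a e ih => intro ρ; simp only [langSig, langIn, ih]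
  | zero => intro ρ; rfl
  | top => intro ρ; rfl
  | plus e f ihe ihf => intro ρ; simp only [langSig, langIn, ihe, ihf]
  | cap e f ihe ihf => intro ρ; simp only [langSig, langIn, ihe, ihf]
  | mu X e ih =>
    intro ρ
    simp only [langSig, langIn]
    rw [lfpStage_top (langSig_body_mono _ X e ρ)]
    simp only [ih]
  | nu X e ih =>
    intro ρ
    simp only [langSig, langIn]
    rw [lfpStage_top (langSig_body_compl_mono _ X e ρ)]
    simp only [ih]
    ext w
    simp only [Set.mem_compl_iff, Set.mem_sInter, Set.mem_sUnion, Set.mem_ofPred_eq, not_forall]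
    constructor
    · rintro ⟨A, hA, hw⟩
      exact ⟨Aᶜ, Set.compl_subset_comm.mp hA, hw⟩
    · rintro ⟨A, hA, hw⟩
      exact ⟨Aᶜ, by simpa using hA, by simpa using hw⟩

theorem langSig_congr {κ κ' : RLL 𝒜 V → WithTop Ordinal.{u}} (e : RLL 𝒜 V)
    (hκ : ∀ g, Sub g e → κ g = κ' g) : ∀ {ρ ρ' : V → Set (Stream' 𝒜)},
    (∀ Y ∈ e.FV, ρ Y = ρ' Y) → e.langSig κ ρ = e.langSig κ' ρ' := by
  have upd : ∀ {ρ ρ' : V → Set (Stream' 𝒜)} {X : V} {S : Set V} (A : Set (Stream' 𝒜)),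
      (∀ Y ∈ S \ {X}, ρ Y = ρ' Y) →
      ∀ Y ∈ S, Function.update ρ X A Y = Function.update ρ' X A Y := by
    intro ρ ρ' X S A h Y hY
    by_cases hYX : Y = X
    · subst hYX; simp
    · simp [hYX, h Y ⟨hY, hYX⟩]
  induction e with
  | var X => intro ρ ρ' h; exact h X rfl
  | letter a e ih =>
    intro ρ ρ' h
    simp only [langSig]
    rw [ih (fun g hg => hκ g (.letter a hg)) h]
  | zero => intros; rfl
  | top => intros; rfl
  | plus e f ihe ihf =>
    intro ρ ρ' h
    simp only [langSig]
    rw [ihe (fun g hg => hκ g (.plus_left _ hg)) fun Y hY => h Y (Or.inl hY),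
      ihf (fun g hg => hκ g (.plus_right _ hg)) fun Y hY => h Y (Or.inr hY)]
  | cap e f ihe ihf =>
    intro ρ ρ' h
    simp only [langSig]
    rw [ihe (fun g hg => hκ g (.cap_left _ hg)) fun Y hY => h Y (Or.inl hY),
      ihf (fun g hg => hκ g (.cap_right _ hg)) fun Y hY => h Y (Or.inr hY)]
  | mu X e ih =>
    intro ρ ρ' h
    simp only [langSig]
    rw [hκ _ (.refl _)]
    congr 1
    funext A
    exact ih (fun g hg => hκ g (.mu X hg)) (upd A h)
  | nu X e ih =>
    intro ρ ρ' h
    simp only [langSig]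
    rw [hκ _ (.refl _)]
    congr 2
    funext A
    rw [ih (fun g hg => hκ g (.nu X hg)) (upd Aᶜ h)]

theorem langSig_subst {κ κ' : RLL 𝒜 V → WithTop Ordinal.{u}} {X : V} {s : RLL 𝒜 V}
    (hs : s.Closed) (hκ : ∀ g, X ∈ g.FV → κ g = ⊤) (hκ' : ∀ g, Sub s g → g ≠ s → κ' g = ⊤)
    (e : RLL 𝒜 V) (h : ∀ g, Sub g e → κ' g = κ g) : ∀ ρ : V → Set (Stream' 𝒜),
    (e.subst X s).langSig κ' ρ = e.langSig κ (Function.update ρ X (s.langSig κ' ρ)) := by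
  have of_notMem : ∀ e : RLL 𝒜 V, X ∉ e.FV → (∀ g, Sub g e → κ' g = κ g) →
      ∀ ρ : V → Set (Stream' 𝒜),
      (e.subst X s).langSig κ' ρ = e.langSig κ (Function.update ρ X (s.langSig κ' ρ)) := by
    intro e hX h ρ
    rw [subst_of_notMem _ _ _ hX]
    refine langSig_congr e h fun Y hY => ?_
    rw [Function.update_of_ne]
    rintro rfl
    exact hX hY
  have upd : ∀ (ρ : V → Set (Stream' 𝒜)) (Y : V) (A : Set (Stream' 𝒜)), Y ≠ X →
      Function.update (Function.update ρ Y A) X (s.langSig κ' (Function.update ρ Y A)) =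
        Function.update (Function.update ρ X (s.langSig κ' ρ)) Y A := by
    intro ρ Y A hYX
    rw [Function.update_comm hYX]
    congr 2
    have hs : s.FV = ∅ := hs
    exact langSig_congr s (fun _ _ => rfl) (by simp [hs])
  have stage : ∀ e f : RLL 𝒜 V, Sub f (e.subst X s) → f.size < (e.subst X s).size → Sub s f →
      X ∈ e.FV → κ' (e.subst X s) = κ e := by
    intro e f hf hlt hsf hX
    rw [hκ e hX]
    refine hκ' _ (hsf.trans hf) ?_
    intro heq
    have := hsf.size_le
    rw [heq] at hlt
    omega
  induction e with
  | var Y =>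
    intro ρ
    by_cases hYX : Y = X
    · subst hYX; simp [subst, langSig]
    · simp [subst, langSig, hYX]
  | letter a e ih =>
    intro ρ
    simp only [langSig, subst]
    rw [ih fun g hg => h g (.letter a hg)]
  | zero => intros; rfl
  | top => intros; rfl
  | plus e f ihe ihf =>
    intro ρ
    simp only [langSig, subst]
    rw [ihe fun g hg => h g (.plus_left _ hg), ihf fun g hg => h g (.plus_right _ hg)]
  | cap e f ihe ihf =>
    intro ρ
    simp only [langSig, subst]
    rw [ihe fun g hg => h g (.cap_left _ hg), ihf fun g hg => h g (.cap_right _ hg)]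
  | mu Y e ih =>
    intro ρ
    by_cases hX : X ∈ (mu Y e : RLL 𝒜 V).FV
    swap
    · exact of_notMem _ hX h ρ
    have hYX : Y ≠ X := fun h' => hX.2 h'.symm
    have hstage := stage (mu Y e) (e.subst X s)
    simp only [subst, hYX, if_false] at hstage ⊢
    simp only [langSig]
    rw [hstage (.mu Y (.refl _)) (by simp [size]) (sub_subst_of_mem_FV s hX.1) hX]
    congr 1
    funext A
    rw [ih fun g hg => h g (.mu Y hg), upd ρ Y A hYX]
  | nu Y e ih =>
    intro ρ
    by_cases hX : X ∈ (nu Y e : RLL 𝒜 V).FV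
    swap
    · exact of_notMem _ hX h ρ
    have hYX : Y ≠ X := fun h' => hX.2 h'.symm
    have hstage := stage (nu Y e) (e.subst X s)
    simp only [subst, hYX, if_false] at hstage ⊢
    simp only [langSig]
    rw [hstage (.nu Y (.refl _)) (by simp [size]) (sub_subst_of_mem_FV s hX.1) hX]
    congr 2
    funext A
    rw [ih fun g hg => h g (.nu Y hg), upd ρ Y Aᶜ hYX]

theorem langSig_resetSig_unfold {κ : RLL 𝒜 V → WithTop Ordinal.{u}}
    (hκ : ∀ g, ¬ g.Closed → κ g = ⊤) {s : RLL 𝒜 V} (hs : s.Closed) (β : WithTop Ordinal.{u})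
    (X : V) {e : RLL 𝒜 V} (he : e.size < s.size) (ρ : V → Set (Stream' 𝒜)) :
    (e.subst X s).langSig (resetSig κ s β) ρ =
      e.langSig κ (Function.update ρ X (s.langSig (resetSig κ s β) ρ)) := by
  apply langSig_subst hs
  · exact fun g hg => hκ g fun h => by have h : g.FV = ∅ := h; simp [h] at hg
  · intro g hg hne
    simp [resetSig, hne, hg]
  · intro g hg
    exact resetSig_of_size_lt κ β (hg.size_le.trans_lt he)

theorem langSig_resetSig_of_size_lt (κ : RLL 𝒜 V → WithTop Ordinal.{u}) {s e : RLL 𝒜 V}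
    (β : WithTop Ordinal.{u}) (he : e.size < s.size) :
    e.langSig (resetSig κ s β) = e.langSig κ := by
  funext ρ
  exact langSig_congr e (fun g hg => resetSig_of_size_lt κ β (hg.size_le.trans_lt he))
    fun _ _ => rfl

theorem langSig_unfold_mu {κ : RLL 𝒜 V → WithTop Ordinal.{u}}
    (hκ : ∀ g, ¬ g.Closed → κ g = ⊤) {X : V} {e : RLL 𝒜 V} (hs : (mu X e).Closed)
    (β : WithTop Ordinal.{u}) (ρ : V → Set (Stream' 𝒜)) :
    (e.subst X (mu X e)).langSig (resetSig κ (mu X e) β) ρ =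
      e.langSig κ (Function.update ρ X
        (lfpStage (fun A => e.langSig κ (Function.update ρ X A)) β)) := by
  have he : e.size < (mu X e).size := by simp [size]
  rw [langSig_resetSig_unfold hκ hs β X he]
  simp only [langSig, resetSig_self, langSig_resetSig_of_size_lt κ β he]

theorem langSig_unfold_nu {κ : RLL 𝒜 V → WithTop Ordinal.{u}}
    (hκ : ∀ g, ¬ g.Closed → κ g = ⊤) {X : V} {e : RLL 𝒜 V} (hs : (nu X e).Closed)
    (β : WithTop Ordinal.{u}) (ρ : V → Set (Stream' 𝒜)) :
    (e.subst X (nu X e)).langSig (resetSig κ (nu X e) β) ρ =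
      e.langSig κ (Function.update ρ X
        (lfpStage (fun A => (e.langSig κ (Function.update ρ X Aᶜ))ᶜ) β)ᶜ) := by
  have he : e.size < (nu X e).size := by simp [size]
  rw [langSig_resetSig_unfold hκ hs β X he]
  simp only [langSig, resetSig_self, langSig_resetSig_of_size_lt κ β he]

end RLL

/-! ### Annotated run-trees and paths -/

namespace APA

variable {𝒜 : Type*} {Q : Type*} {K : Type*}

theorem nodeAt_eq_cons {α : Type*} (π : ℕ → α) (n : ℕ) : ∃ h, nodeAt π n = π n :: h := by
  cases n with
  | zero => exact ⟨[], rfl⟩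
  | succ n => exact ⟨_, rfl⟩

/-- The annotation of a node, starting from `κ₀` at the root and updated by `next` along edges. -/
def annotate {α : Type*} (κ₀ : K) (next : α → K → α → K) : List α → K
  | q :: p :: h => next p (annotate κ₀ next (p :: h)) q
  | _ => κ₀

/-- The run-tree in which the child of an existential node is chosen by `ch`, depending on the
label and the annotation of the node. -/
inductive StrategyTree (M : APA 𝒜 Q) (w : Stream' 𝒜) (κ₀ : K)
    (next : Stream' 𝒜 × Q → K → Stream' 𝒜 × Q → K)
    (ch : Stream' 𝒜 × Q → K → Stream' 𝒜 × Q) : List (Stream' 𝒜 × Q) → Prop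
  | root : StrategyTree M w κ₀ next ch [(w, M.init)]
  | existential {p h} : StrategyTree M w κ₀ next ch (p :: h) → p.2 ∈ M.existential →
      StrategyTree M w κ₀ next ch (ch p (annotate κ₀ next (p :: h)) :: p :: h)
  | universal {p h q} : StrategyTree M w κ₀ next ch (p :: h) → p.2 ∉ M.existential →
      M.Succ p q → StrategyTree M w κ₀ next ch (q :: p :: h)

/-- If the existential player can maintain an invariant `I` between labels and annotations, then
there is a run-tree along every path of which the invariant is maintained. -/
theorem exists_isRunTree_of_invariant (M : APA 𝒜 Q) (I : Stream' 𝒜 × Q → K → Prop)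
    (D : Stream' 𝒜 × Q → K → K → Prop) (w : Stream' 𝒜) (κ₀ : K) (h₀ : I (w, M.init) κ₀)
    (hex : ∀ p κ, I p κ → p.2 ∈ M.existential → ∃ q κ', M.Succ p q ∧ I q κ' ∧ D p κ κ')
    (hall : ∀ p κ q, I p κ → p.2 ∉ M.existential → M.Succ p q → ∃ κ', I q κ' ∧ D p κ κ') :
    ∃ T, M.IsRunTree w T ∧ ∀ π, IsPath T π → ∃ κ : ℕ → K,
      ∀ n, D (π n) (κ n) (κ (n + 1)) ∧ M.Succ (π n) (π (n + 1)) := by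
  have hch : ∀ p κ, ∃ q, I p κ → p.2 ∈ M.existential →
      M.Succ p q ∧ ∃ κ', I q κ' ∧ D p κ κ' := by
    intro p κ
    by_cases h : I p κ ∧ p.2 ∈ M.existential
    · obtain ⟨q, κ', h1, h2⟩ := hex p κ h.1 h.2
      exact ⟨q, fun _ _ => ⟨h1, κ', h2⟩⟩
    · exact ⟨p, fun h1 h2 => (h ⟨h1, h2⟩).elim⟩
  choose ch hch using hch
  have hnext : ∀ p κ q, ∃ κ', (∃ κ'', I q κ'' ∧ D p κ κ'') → I q κ' ∧ D p κ κ' := by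
    intro p κ q
    by_cases h : ∃ κ'', I q κ'' ∧ D p κ κ''
    · exact ⟨h.choose, fun _ => h.choose_spec⟩
    · exact ⟨κ₀, fun h' => (h h').elim⟩
  choose next hnext using hnext
  have step : ∀ p h q, I p (annotate κ₀ next (p :: h)) →
      StrategyTree M w κ₀ next ch (q :: p :: h) → M.Succ p q ∧
        I q (annotate κ₀ next (q :: p :: h)) ∧
        D p (annotate κ₀ next (p :: h)) (annotate κ₀ next (q :: p :: h)) := by
    intro p h q hI hT
    cases hT with
    | existential hT hp =>
      obtain ⟨h1, h2⟩ := hch _ _ hI hp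
      exact ⟨h1, hnext _ _ _ h2⟩
    | universal hT hp hs => exact ⟨hs, hnext _ _ _ (hall _ _ _ hI hp hs)⟩
  have inv : ∀ n, StrategyTree M w κ₀ next ch n → ∀ p h, n = p :: h →
      I p (annotate κ₀ next n) := by
    intro n hn
    induction hn with
    | root =>
      rintro p h ⟨⟩
      exact h₀
    | existential hT hp ih =>
      rintro p h ⟨⟩
      exact (step _ _ _ (ih _ _ rfl) (.existential hT hp)).2.1
    | universal hT hp hs ih =>
      rintro p h ⟨⟩
      exact (step _ _ _ (ih _ _ rfl) (.universal hT hp hs)).2.1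
  refine ⟨{n | StrategyTree M w κ₀ next ch n}, ⟨.root, ?_, ?_, ?_⟩, ?_⟩
  · rintro n hn
    cases hn with
    | root => exact Or.inl rfl
    | existential hT hp => exact Or.inr ⟨_, _, hT, rfl⟩
    | universal hT hp hs => exact Or.inr ⟨_, _, hT, rfl⟩
  · intro p h hT hp
    refine ⟨ch p (annotate κ₀ next (p :: h)), (hch _ _ (inv _ hT _ _ rfl) hp).1, fun r => ?_⟩
    constructor
    · intro hr
      cases hr with
      | existential => rfl
      | universal _ hp' => exact (hp' hp).elim
    · rintro rfl
      exact .existential hT hp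
  · intro p h hT hp r
    exact ⟨fun hr => (step _ _ _ (inv _ hT _ _ rfl) hr).1, fun hs => .universal hT hp hs⟩
  · intro π hπ
    refine ⟨fun n => annotate κ₀ next (nodeAt π n), fun n => ?_⟩
    have hn : StrategyTree M w κ₀ next ch (nodeAt π n) := hπ n
    have hn' : StrategyTree M w κ₀ next ch (π (n + 1) :: nodeAt π n) := hπ (n + 1)
    obtain ⟨h, hh⟩ := nodeAt_eq_cons π n
    simp only [nodeAt]
    rw [hh] at hn hn' ⊢
    have := step _ _ _ (inv _ hn _ _ rfl) hn'
    exact ⟨this.2.2, this.1⟩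

/-- If the universal player can maintain an invariant `I` between labels and annotations, then
every run-tree has a path along which the invariant is maintained. -/
theorem IsRunTree.exists_path_of_invariant {M : APA 𝒜 Q} {w : Stream' 𝒜}
    {T : Set (List (Stream' 𝒜 × Q))} (hT : M.IsRunTree w T) (I : Stream' 𝒜 × Q → K → Prop)
    (D : Stream' 𝒜 × Q → K → K → Prop) (κ₀ : K) (h₀ : I (w, M.init) κ₀)
    (hex : ∀ p κ q, I p κ → p.2 ∈ M.existential → M.Succ p q → ∃ κ', I q κ' ∧ D p κ κ')
    (hall : ∀ p κ, I p κ → p.2 ∉ M.existential → ∃ q κ', M.Succ p q ∧ I q κ' ∧ D p κ κ') :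
    ∃ π, IsPath T π ∧ ∃ κ : ℕ → K,
      ∀ n, D (π n) (κ n) (κ (n + 1)) ∧ M.Succ (π n) (π (n + 1)) := by
  let N := {x : (Stream' 𝒜 × Q) × List (Stream' 𝒜 × Q) × K // x.1 :: x.2.1 ∈ T ∧ I x.1 x.2.2}
  have hstep : ∀ x : N, ∃ y : N, y.1.2.1 = x.1.1 :: x.1.2.1 ∧ D x.1.1 x.1.2.2 y.1.2.2 ∧
      M.Succ x.1.1 y.1.1 := by
    rintro ⟨⟨p, h, κ⟩, hT', hI⟩
    by_cases hp : p.2 ∈ M.existential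
    · obtain ⟨q, hs, hq⟩ := hT.exists_child p h hT' hp
      obtain ⟨κ', hI', hD⟩ := hex p κ q hI hp hs
      exact ⟨⟨⟨q, p :: h, κ'⟩, (hq q).mpr rfl, hI'⟩, rfl, hD, hs⟩
    · obtain ⟨q, κ', hs, hI', hD⟩ := hall p κ hI hp
      exact ⟨⟨⟨q, p :: h, κ'⟩, (hT.forall_child p h hT' hp q).mpr hs, hI'⟩, rfl, hD, hs⟩
  choose f hf using hstep
  let x : ℕ → N := fun n => f^[n] ⟨⟨(w, M.init), [], κ₀⟩, hT.root_mem, h₀⟩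
  have hx : ∀ n, x (n + 1) = f (x n) := fun n => Function.iterate_succ_apply' f n _
  have hnode : ∀ n, nodeAt (fun n => (x n).1.1) n = (x n).1.1 :: (x n).1.2.1 := by
    intro n
    induction n with
    | zero => rfl
    | succ n ih =>
      rw [nodeAt, ih]
      congr 1
      rw [hx, (hf (x n)).1]
  refine ⟨fun n => (x n).1.1, fun n => ?_, fun n => (x n).1.2.2, fun n => ?_⟩
  · rw [hnode]
    exact (x n).2.1
  · simp only [hx]
    exact (hf (x n)).2

end APA

/-! ### The automaton of an expression -/

namespace RLL

universe u

variable {𝒜 : Type u} {V : Type*} [DecidableEq V]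

theorem flStep_of_succ {e : RLL 𝒜 V} {he : e.Closed} {E : Set e.FL} {c : e.FL → ℕ}
    {p q : Stream' 𝒜 × e.FL} (h : (e.automaton he E c).Succ p q) : FLStep p.2.1 q.2.1 := by
  cases h with
  | eps v h => exact h.1
  | read v h =>
    have h : _ = RLL.letter _ _ := h
    simp only [h]
    exact .letter _ _

theorem succ_of_flStep {e : RLL 𝒜 V} (he : e.Closed) (E : Set e.FL) (c : e.FL → ℕ)
    (w : Stream' 𝒜) (p : e.FL) {g : RLL 𝒜 V} (h : FLStep p.1 g) (hp : ∀ a f, p.1 ≠ .letter a f) :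
    (e.automaton he E c).Succ (w, p) (w, ⟨g, p.2.tail h⟩) :=
  .eps w ⟨h, hp⟩

/-- The least colour seen infinitely often along an infinite trace is that of some fixed point
formula which is visited infinitely often and eventually is a subformula of all formulas visited. -/
theorem exists_isLeast_colour {e : RLL 𝒜 V} (he : e.Closed) {c : e.FL → ℕ} (hc : e.IsColouring c)
    (t : ℕ → e.FL) (ht : ∀ n, FLStep (t n).1 (t (n + 1)).1) :
    ∃ s : e.FL, (∃ᶠ n in Filter.atTop, t n = s) ∧ (∀ᶠ n in Filter.atTop, Sub s.1 (t n).1) ∧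
      ((∃ X f, s.1 = .mu X f) ∨ ∃ X f, s.1 = .nu X f) ∧
      IsLeast {k | ∃ᶠ n in Filter.atTop, c (t n) = k} (c s) := by
  obtain ⟨s, hs, hsub, hfix⟩ := exists_frequently_eventually_sub (FL_finite he) t ht
  refine ⟨s, hs, hsub, hfix, hs.mono fun n hn => by rw [hn], fun k hk => ?_⟩
  obtain ⟨n, hn, hn'⟩ := (Filter.Frequently.and_eventually hk hsub).exists
  rw [← hn]
  exact hc.mono _ _ hn'

theorem exists_sig_mem_unfold_mu {κ : RLL 𝒜 V → WithTop Ordinal.{u}} (hκ : IsSig IsMu κ) {X : V}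
    {f : RLL 𝒜 V} (hf : (mu X f).Closed) {ρ : V → Set (Stream' 𝒜)} {w : Stream' 𝒜}
    (hw : w ∈ (mu X f).langSig κ ρ) :
    ∃ κ', (IsSig IsMu κ' ∧ w ∈ (f.subst X (mu X f)).langSig κ' ρ) ∧
      SigStep IsMu (mu X f) κ κ' := by
  obtain ⟨β, hβ, hw⟩ := mem_lfpStage.mp hw
  refine ⟨resetSig κ (mu X f) β, ⟨hκ.resetSig (Or.inl ⟨hf, X, f, rfl⟩), ?_⟩,
    .resetSig_of_lt _ hβ⟩
  rwa [langSig_unfold_mu hκ.eq_top_of_not_closed hf]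

theorem exists_sig_mem_unfold_nu {κ : RLL 𝒜 V → WithTop Ordinal.{u}} (hκ : IsSig IsMu κ) {X : V}
    {f : RLL 𝒜 V} (hf : (nu X f).Closed) {ρ : V → Set (Stream' 𝒜)} {w : Stream' 𝒜}
    (hw : w ∈ (nu X f).langSig κ ρ) :
    ∃ κ', (IsSig IsMu κ' ∧ w ∈ (f.subst X (nu X f)).langSig κ' ρ) ∧
      SigStep IsMu (nu X f) κ κ' := by
  have hnot : ¬ IsMu (nu X f : RLL 𝒜 V) := by rintro ⟨_, _, ⟨⟩⟩
  have htop : κ (nu X f) = ⊤ := hκ _ fun h => hnot h.2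
  refine ⟨resetSig κ (nu X f) ⊤, ⟨hκ.resetSig (Or.inr rfl), ?_⟩, .resetSig_top hnot htop⟩
  rw [langSig_unfold_nu hκ.eq_top_of_not_closed hf]
  simp only [langSig, htop] at hw
  by_contra hc
  exact hw (image_lfpStage_top_subset (langSig_body_compl_mono κ X f ρ) hc)

theorem exists_sig_notMem_unfold_nu {κ : RLL 𝒜 V → WithTop Ordinal.{u}} (hκ : IsSig IsNu κ)
    {X : V} {f : RLL 𝒜 V} (hf : (nu X f).Closed) {ρ : V → Set (Stream' 𝒜)} {w : Stream' 𝒜}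
    (hw : w ∉ (nu X f).langSig κ ρ) :
    ∃ κ', (IsSig IsNu κ' ∧ w ∉ (f.subst X (nu X f)).langSig κ' ρ) ∧
      SigStep IsNu (nu X f) κ κ' := by
  obtain ⟨β, hβ, hw⟩ := mem_lfpStage.mp (not_not.mp hw)
  refine ⟨resetSig κ (nu X f) β, ⟨hκ.resetSig (Or.inl ⟨hf, X, f, rfl⟩), ?_⟩,
    .resetSig_of_lt _ hβ⟩
  rwa [langSig_unfold_nu hκ.eq_top_of_not_closed hf]

theorem exists_sig_notMem_unfold_mu {κ : RLL 𝒜 V → WithTop Ordinal.{u}} (hκ : IsSig IsNu κ)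
    {X : V} {f : RLL 𝒜 V} (hf : (mu X f).Closed) {ρ : V → Set (Stream' 𝒜)} {w : Stream' 𝒜}
    (hw : w ∉ (mu X f).langSig κ ρ) :
    ∃ κ', (IsSig IsNu κ' ∧ w ∉ (f.subst X (mu X f)).langSig κ' ρ) ∧
      SigStep IsNu (mu X f) κ κ' := by
  have hnot : ¬ IsNu (mu X f : RLL 𝒜 V) := by rintro ⟨_, _, ⟨⟩⟩
  have htop : κ (mu X f) = ⊤ := hκ _ fun h => hnot h.2
  refine ⟨resetSig κ (mu X f) ⊤, ⟨hκ.resetSig (Or.inr rfl), ?_⟩, .resetSig_top hnot htop⟩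
  rw [langSig_unfold_mu hκ.eq_top_of_not_closed hf]
  simp only [langSig, htop] at hw
  exact fun hc => hw (image_lfpStage_top_subset (langSig_body_mono κ X f ρ) hc)

theorem lang_subset_automaton_lang (e : RLL 𝒜 V) (he : e.Closed) (E : Set e.FL)
    (hE : e.IsExistentialSet E) (c : e.FL → ℕ) (hc : e.IsColouring c) :
    e.lang ⊆ (e.automaton he E c).lang := by
  intro w hw
  refine Exists.elim ((e.automaton he E c).exists_isRunTree_of_invariant
    (fun p κ => IsSig IsMu κ ∧ p.1 ∈ p.2.1.langSig κ fun _ => ∅)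
    (fun p κ κ' => SigStep IsMu p.2.1 κ κ') w (fun _ => ⊤)
    ⟨fun _ _ => rfl, by rw [langSig_top]; exact hw⟩ ?_ ?_) fun T ⟨hT, hpath⟩ => ?_
  · rintro ⟨w, f, hf⟩ κ ⟨hκ, hw⟩ hp
    have hcl := closed_of_mem_FL he hf
    have hp : (⟨f, hf⟩ : e.FL) ∈ E := hp
    cases f with
    | var X => exact (Set.singleton_ne_empty X hcl).elim
    | letter a f =>
      obtain ⟨v, hv, rfl⟩ := hw
      exact ⟨(v, ⟨f, hf.tail (.letter a f)⟩), κ, .read v rfl, ⟨hκ, hv⟩,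
        .refl (by rintro ⟨_, _, ⟨⟩⟩) κ⟩
    | zero => exact hw.elim
    | top => exact (hE.top _ rfl hp).elim
    | plus f g =>
      rcases hw with hw | hw
      · exact ⟨_, κ, succ_of_flStep he E c w ⟨_, hf⟩ (.plus_left f g) (by simp), ⟨hκ, hw⟩,
          .refl (by rintro ⟨_, _, ⟨⟩⟩) κ⟩
      · exact ⟨_, κ, succ_of_flStep he E c w ⟨_, hf⟩ (.plus_right f g) (by simp), ⟨hκ, hw⟩,
          .refl (by rintro ⟨_, _, ⟨⟩⟩) κ⟩
    | cap f g => exact (hE.cap _ f g rfl hp).elim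
    | mu X f =>
      obtain ⟨κ', hκ', hstep⟩ := exists_sig_mem_unfold_mu hκ hcl hw
      exact ⟨_, κ', succ_of_flStep he E c w ⟨_, hf⟩ (.mu X f) (by simp), hκ', hstep⟩
    | nu X f =>
      obtain ⟨κ', hκ', hstep⟩ := exists_sig_mem_unfold_nu hκ hcl hw
      exact ⟨_, κ', succ_of_flStep he E c w ⟨_, hf⟩ (.nu X f) (by simp), hκ', hstep⟩
  · rintro ⟨w, f, hf⟩ κ q ⟨hκ, hw⟩ hp hs
    have hcl := closed_of_mem_FL he hf
    have hp : (⟨f, hf⟩ : e.FL) ∉ E := hp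
    cases hs with
    | read v h => exact (hp (hE.letter _ _ _ h)).elim
    | @eps _ g _ h =>
      obtain ⟨g, hg⟩ := g
      obtain ⟨h, -⟩ := h
      have h : FLStep f g := h
      cases h with
      | letter a f => exact (hp (hE.letter _ _ _ rfl)).elim
      | plus_left f g => exact (hp (hE.plus _ _ _ rfl)).elim
      | plus_right f g => exact (hp (hE.plus _ _ _ rfl)).elim
      | cap_left f g => exact ⟨κ, ⟨hκ, hw.1⟩, .refl (by rintro ⟨_, _, ⟨⟩⟩) κ⟩
      | cap_right f g => exact ⟨κ, ⟨hκ, hw.2⟩, .refl (by rintro ⟨_, _, ⟨⟩⟩) κ⟩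
      | mu X f => exact exists_sig_mem_unfold_mu hκ hcl hw
      | nu X f => exact exists_sig_mem_unfold_nu hκ hcl hw
  · refine ⟨T, hT, fun π hπ => ?_⟩
    obtain ⟨κ, hκ⟩ := hpath π hπ
    obtain ⟨s, hs, hsub, hfix, hleast⟩ := exists_isLeast_colour he hc (fun n => (π n).2)
      fun n => flStep_of_succ (hκ n).2
    refine ⟨c s, hleast, ?_⟩
    rcases hfix with hmu | ⟨X, f, hnu⟩
    · exact (not_frequently_of_sigStep (fun n => (hκ n).1) hmu hsub
        (hs.mono fun n hn => congrArg Subtype.val hn)).elim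
    · exact hc.nu s X f hnu

theorem automaton_lang_subset_lang (e : RLL 𝒜 V) (he : e.Closed) (E : Set e.FL)
    (hE : e.IsExistentialSet E) (c : e.FL → ℕ) (hc : e.IsColouring c) :
    (e.automaton he E c).lang ⊆ e.lang := by
  rintro w ⟨T, hT, hacc⟩
  by_contra hw
  refine Exists.elim (hT.exists_path_of_invariant
    (fun p κ => IsSig IsNu κ ∧ p.1 ∉ p.2.1.langSig κ fun _ => ∅)
    (fun p κ κ' => SigStep IsNu p.2.1 κ κ') (fun _ => ⊤)
    ⟨fun _ _ => rfl, by rw [langSig_top]; exact hw⟩ ?_ ?_) fun π ⟨hπ, κ, hκ⟩ => ?_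
  · rintro ⟨w, f, hf⟩ κ q ⟨hκ, hw⟩ hp hs
    have hcl := closed_of_mem_FL he hf
    have hp : (⟨f, hf⟩ : e.FL) ∈ E := hp
    cases hs with
    | @read _ g a v h =>
      have h : f = .letter a g.1 := h
      subst h
      exact ⟨κ, ⟨hκ, fun hv => hw ⟨v, hv, rfl⟩⟩, .refl (by rintro ⟨_, _, ⟨⟩⟩) κ⟩
    | @eps _ g _ h =>
      obtain ⟨g, hg⟩ := g
      obtain ⟨h, hne⟩ := h
      have h : FLStep f g := h
      cases h with
      | letter a f => exact (hne _ _ rfl).elim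
      | plus_left f g =>
        exact ⟨κ, ⟨hκ, fun h => hw (Or.inl h)⟩, .refl (by rintro ⟨_, _, ⟨⟩⟩) κ⟩
      | plus_right f g =>
        exact ⟨κ, ⟨hκ, fun h => hw (Or.inr h)⟩, .refl (by rintro ⟨_, _, ⟨⟩⟩) κ⟩
      | cap_left f g => exact (hE.cap _ _ _ rfl hp).elim
      | cap_right f g => exact (hE.cap _ _ _ rfl hp).elim
      | mu X f => exact exists_sig_notMem_unfold_mu hκ hcl hw
      | nu X f => exact exists_sig_notMem_unfold_nu hκ hcl hw
  · rintro ⟨w, f, hf⟩ κ ⟨hκ, hw⟩ hp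
    have hcl := closed_of_mem_FL he hf
    have hp : (⟨f, hf⟩ : e.FL) ∉ E := hp
    cases f with
    | var X => exact (Set.singleton_ne_empty X hcl).elim
    | letter a f => exact (hp (hE.letter _ _ _ rfl)).elim
    | zero => exact (hp (hE.zero _ rfl)).elim
    | top => exact (hw trivial).elim
    | plus f g => exact (hp (hE.plus _ _ _ rfl)).elim
    | cap f g =>
      rcases not_and_or.mp hw with hw | hw
      · exact ⟨_, κ, succ_of_flStep he E c w ⟨_, hf⟩ (.cap_left f g) (by simp), ⟨hκ, hw⟩,
          .refl (by rintro ⟨_, _, ⟨⟩⟩) κ⟩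
      · exact ⟨_, κ, succ_of_flStep he E c w ⟨_, hf⟩ (.cap_right f g) (by simp), ⟨hκ, hw⟩,
          .refl (by rintro ⟨_, _, ⟨⟩⟩) κ⟩
    | mu X f =>
      obtain ⟨κ', hκ', hstep⟩ := exists_sig_notMem_unfold_mu hκ hcl hw
      exact ⟨_, κ', succ_of_flStep he E c w ⟨_, hf⟩ (.mu X f) (by simp), hκ', hstep⟩
    | nu X f =>
      obtain ⟨κ', hκ', hstep⟩ := exists_sig_notMem_unfold_nu hκ hcl hw
      exact ⟨_, κ', succ_of_flStep he E c w ⟨_, hf⟩ (.nu X f) (by simp), hκ', hstep⟩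
  · obtain ⟨s, hs, hsub, hfix, hleast⟩ := exists_isLeast_colour he hc (fun n => (π n).2)
      fun n => flStep_of_succ (hκ n).2
    obtain ⟨k, hk, hkeven⟩ := hacc π hπ
    obtain rfl : k = c s := hk.unique hleast
    rcases hfix with ⟨X, f, hmu⟩ | hnu
    · exact Nat.not_even_iff_odd.mpr (hc.mu s X f hmu) hkeven
    · exact not_frequently_of_sigStep (fun n => (hκ n).1) hnu hsub
        (hs.mono fun n hn => congrArg Subtype.val hn)

end RLL

theorem mainTheorem3 {𝒜 : Type*} [Finite 𝒜] {V : Type*} [Countable V] [DecidableEq V]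
    (e : RLL 𝒜 V) (he : e.Closed)
    (E : Set e.FL) (hE : e.IsExistentialSet E)
    (c : e.FL → ℕ) (hc : e.IsColouring c) :
    e.lang = (e.automaton he E c).lang :=
  (e.lang_subset_automaton_lang he E hE c hc).antisymm (e.automaton_lang_subset_lang he E hE c hc)
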